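/- Let $q$ be a prime power. For integers $d\ge 1$ and $0\le k\le n$ let $A_q(n,d;k)$ be the maximum size of a set of $k$-dimensional subspaces of $\mathbb{F}_q^n$ in which any two distinct members $U,W$ satisfy $\dim(U+W)-\dim(U\cap W)\ge d$. For even $d\ge 2$ and $1\le k\le n$ let $M(q,k,n,d)$ be the size of a lifted maximum rank distance code of $k$-dimensional subspaces of $\mathbb{F}_q^n$ with subspace distance $d$, i.e. $$M(q,k,n,d)=q^{\max\{k,n-k\}\cdot(\min\{k,n-k\}-d/2+1)}\quad\text{if } d\le 2\min\{k,n-k\},$$ and $M(q,k,n,d)=1$ otherwise. Then for all positive integers $k,m,v,d$ with $d$ even, $d\le 2k$ and $k\le m\le v-d/2$, $$A_q(v,d;k)\;\ge\; A_q(m,d;k)\cdot M(q,k,v-m+k,d)+A_q(v-m+k-d/2,d;k).$$ -/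

import Mathlib

/-- The subspace distance `dim (U + W) - dim (U ∩ W)` (no truncation occurs in finite dimension,
as `U ∩ W ≤ U + W`). -/
noncomputable def subspaceDist {F V : Type*} [Field F] [AddCommGroup V] [Module F V]
    (U W : Submodule F V) : ℕ :=
  Module.finrank F ↥(U ⊔ W) - Module.finrank F ↥(U ⊓ W)

/-- `C` is a constant dimension code in `F^v`: all codewords are `k`-dimensional subspaces, and
any two distinct codewords have subspace distance at least `d`. (A code with at most one codeword
satisfies every distance requirement.) -/
def IsConstDimCode (F : Type*) [Field F] (v d k : ℕ)
    (C : Finset (Submodule F (Fin v → F))) : Prop :=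
  (∀ U ∈ C, Module.finrank F ↥U = k) ∧
    ∀ U ∈ C, ∀ W ∈ C, U ≠ W → d ≤ subspaceDist U W

/-- `A_q(v,d;k)` for `q = #F`: the maximum size of a constant dimension code in `F^v` with
codewords of dimension `k` and minimum subspace distance at least `d`. -/
noncomputable def maxCodeSize (F : Type*) [Field F] (v d k : ℕ) : ℕ :=
  sSup {N : ℕ | ∃ C : Finset (Submodule F (Fin v → F)), IsConstDimCode F v d k C ∧ C.card = N}

/-- Over a finite field the supremum in `maxCodeSize` is an attained maximum. -/
theorem isGreatest_maxCodeSize (F : Type*) [Field F] [Finite F] (v d k : ℕ) :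
    IsGreatest
      {N : ℕ | ∃ C : Finset (Submodule F (Fin v → F)), IsConstDimCode F v d k C ∧ C.card = N}
      (maxCodeSize F v d k) := by
  have hfin : Finite (Submodule F (Fin v → F)) :=
    Finite.of_injective (fun U => (U : Set (Fin v → F))) SetLike.coe_injective
  have hb : BddAbove
      {N : ℕ | ∃ C : Finset (Submodule F (Fin v → F)), IsConstDimCode F v d k C ∧ C.card = N} := by
    refine ⟨Nat.card (Submodule F (Fin v → F)), ?_⟩
    rintro N ⟨C, -, rfl⟩
    have := Fintype.ofFinite (Submodule F (Fin v → F))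
    rw [Nat.card_eq_fintype_card]
    exact C.card_le_univ
  refine ⟨Nat.sSup_mem ⟨0, ∅, ⟨by simp, by simp⟩, by simp⟩ hb, fun N hN => le_csSup hb hN⟩

/-- `M(q,k,v,d)`, the size of a lifted MRD code of `k`-dimensional subspaces of `𝔽_q^v` with
subspace distance `d` (for `k ≤ v` and `d` even). -/
def lmrdSize (q k v d : ℕ) : ℕ :=
  if d ≤ 2 * min k (v - k) then q ^ (max k (v - k) * (min k (v - k) - d / 2 + 1)) else 1

/-!
Write `d = 2δ` and `n = v - m`, and identify `F^v` with `F^m × F^n`. Two `k`-dimensional subspaces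
have subspace distance at least `2δ` exactly when they meet in dimension at most `k - δ`, so the
claim follows from exhibiting a large family with pairwise intersections of dimension at most
`k - δ` (`card_le_maxCodeSize`). The family is the union of two parts.

* For every codeword `U` of an optimal code in `F^m`, parametrised by an injection `A : F^k → F^m`,
  and every `B` in a maximum rank distance code of linear maps `F^k → F^n`, take the image of
  `x ↦ (A x, B x)`. The projection to `F^m` is injective on this subspace. Hence, for different `U`,
  intersections are no larger than in the code in `F^m` (`finrank_range_prod_inf_le`); for equal `U`,
  the intersection comes from the kernel of a difference of two maps of the rank code
  (`finrank_range_prod_inf_range_prod_le`).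
* Take an optimal code in `S × F^n`, where `S ≤ F^m` has dimension `k - δ`. A member of the first
  part meets `S × F^n` in a subspace that projects injectively to `S`, so again in dimension at most
  `k - δ`.

The maximum rank distance code is the Gabidulin code (`exists_rankCode`): a nonzero `q`-polynomial
`∑ i < r, aᵢ X^(q^i)` over the extension `L` of degree `N` of `F` has at most `q^(r-1)` roots, so as
an `F`-linear map it has a kernel of dimension less than `r`. This persists after restriction to an
`F`-subspace of `L`, and transposing matrices covers the other shape.
-/

/-! ### The Gabidulin code -/

section Gabidulin

variable {F L : Type*} [Field F] [Fintype F] [Field L] [Algebra F L] {r : ℕ}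

/-- The `F`-linear map `x ↦ ∑ i, a i * x ^ (q ^ i)` on an extension `L` of `F`, with `q = #F`. -/
noncomputable def qPolyMap (F : Type*) {L : Type*} [Field F] [Fintype F] [Field L] [Algebra F L]
    {r : ℕ} (a : Fin r → L) : L →ₗ[F] L :=
  ∑ i, LinearMap.mulLeft F (a i) ∘ₗ (FiniteField.frobeniusAlgHom F L ^ (i : ℕ)).toLinearMap

theorem qPolyMap_apply (a : Fin r → L) (x : L) :
    qPolyMap F a x = ∑ i, a i * x ^ (Fintype.card F ^ (i : ℕ)) := by
  simp [qPolyMap, LinearMap.sum_apply, AlgHom.coe_pow, FiniteField.coe_frobeniusAlgHom, pow_iterate]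

theorem qPolyMap_sub (a b : Fin r → L) : qPolyMap F (a - b) = qPolyMap F a - qPolyMap F b := by
  ext x
  simp [qPolyMap_apply, sub_mul]

/-- The kernel consists of roots of a nonzero polynomial of degree at most `q ^ (r - 1)`. -/
theorem finrank_ker_qPolyMap_lt [Finite L] {a : Fin r → L} (ha : a ≠ 0) :
    Module.finrank F (LinearMap.ker (qPolyMap F a)) < r := by
  classical
  have hq : 1 < Fintype.card F := Fintype.one_lt_card
  obtain ⟨i₀, hi₀⟩ := Function.ne_iff.mp ha
  have hr : 0 < r := i₀.pos
  let P : Polynomial L := ∑ i : Fin r, Polynomial.monomial (Fintype.card F ^ (i : ℕ)) (a i)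
  have hP : P ≠ 0 := by
    intro h
    apply hi₀
    have hc := congrArg (fun p => Polynomial.coeff p (Fintype.card F ^ (i₀ : ℕ))) h
    simpa [P, Polynomial.finsetSum_coeff, Polynomial.coeff_monomial, pow_right_inj₀
      (Nat.zero_lt_of_lt hq) hq.ne', Fin.val_inj] using hc
  have hdeg : P.natDegree ≤ Fintype.card F ^ (r - 1) := by
    refine Polynomial.natDegree_sum_le_of_forall_le _ _ fun i _ => ?_
    refine (Polynomial.natDegree_monomial_le _).trans (Nat.pow_le_pow_right hq.le ?_)
    omega
  have hsub : (LinearMap.ker (qPolyMap F a) : Set L) ⊆ P.roots.toFinset := by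
    intro x hx
    have hx' : qPolyMap F a x = 0 := hx
    rw [qPolyMap_apply] at hx'
    simpa [hP, Polynomial.IsRoot, P, Polynomial.eval_finsetSum] using hx'
  have hcard : Fintype.card F ^ Module.finrank F (LinearMap.ker (qPolyMap F a))
      ≤ Fintype.card F ^ (r - 1) := by
    rw [← Nat.card_eq_fintype_card (α := F), ← Module.natCard_eq_pow_finrank]
    calc Nat.card (LinearMap.ker (qPolyMap F a))
        = (LinearMap.ker (qPolyMap F a) : Set L).ncard := rfl
      _ ≤ (P.roots.toFinset : Set L).ncard := Set.ncard_le_ncard hsub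
      _ ≤ P.natDegree := by
        rw [Set.ncard_coe_finset]
        exact (Multiset.toFinset_card_le _).trans P.card_roots'
      _ ≤ Nat.card F ^ (r - 1) := by rwa [Nat.card_eq_fintype_card]
  have := (Nat.pow_le_pow_iff_right hq).mp hcard
  omega

end Gabidulin

theorem exists_injective_linearMap_of_le_finrank {F V : Type*} [Field F] [AddCommGroup V]
    [Module F V] [FiniteDimensional F V] {n : ℕ} (h : n ≤ Module.finrank F V) :
    ∃ f : (Fin n → F) →ₗ[F] V, Function.Injective f := by
  obtain ⟨b, hb⟩ := exists_linearIndependent_of_le_finrank h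
  exact ⟨_, hb.fintypeLinearCombination_injective⟩

theorem finrank_map_of_injective {F V W : Type*} [Field F] [AddCommGroup V] [Module F V]
    [AddCommGroup W] [Module F W] {f : V →ₗ[F] W} (hf : Function.Injective f)
    (U : Submodule F V) : Module.finrank F (U.map f) = Module.finrank F U :=
  (Submodule.equivMapOfInjective f hf U).finrank_eq.symm

/-- Maximum rank distance codes for matrices with at least as many rows as columns. -/
theorem exists_rankCode_of_le (F : Type*) [Field F] [Finite F] {s N δ : ℕ} (hδ : 0 < δ)
    (hs : δ ≤ s) (hN : s ≤ N) :
    ∃ f : Fin (Nat.card F ^ (N * (s - δ + 1))) → Matrix (Fin N) (Fin s) F,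
      ∀ i j, i ≠ j → δ ≤ (f i - f j).rank := by
  have := Fintype.ofFinite F
  obtain ⟨p, hp⟩ := CharP.exists F
  have : Fact p.Prime := ⟨CharP.char_is_prime F p⟩
  have : NeZero N := ⟨by omega⟩
  let L := FiniteField.Extension F p N
  have hL : Module.finrank F L = N := FiniteField.finrank_extension F p N
  obtain ⟨g, hg⟩ := exists_injective_linearMap_of_le_finrank (F := F) (V := L) (hN.trans hL.ge)
  let e : L ≃ₗ[F] (Fin N → F) := LinearEquiv.ofFinrankEq _ _ (by simp [hL])
  have hcard : Nat.card (Fin (s - δ + 1) → L) = Nat.card F ^ (N * (s - δ + 1)) := by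
    rw [Nat.card_fun, FiniteField.natCard_extension, Nat.card_fin, pow_mul]
  let c := (Finite.equivFinOfCardEq hcard).symm
  refine ⟨fun i => LinearMap.toMatrix' (e.toLinearMap ∘ₗ qPolyMap F (c i) ∘ₗ g), fun i j hij => ?_⟩
  have hne : c i - c j ≠ 0 := sub_ne_zero.mpr (c.injective.ne hij)
  have hker := finrank_ker_qPolyMap_lt (F := F) hne
  have hsub : LinearMap.toMatrix' (e.toLinearMap ∘ₗ qPolyMap F (c i) ∘ₗ g)
      - LinearMap.toMatrix' (e.toLinearMap ∘ₗ qPolyMap F (c j) ∘ₗ g)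
      = LinearMap.toMatrix' (e.toLinearMap ∘ₗ qPolyMap F (c i - c j) ∘ₗ g) := by
    rw [← map_sub, qPolyMap_sub, LinearMap.sub_comp, LinearMap.comp_sub]
  rw [hsub, Matrix.rank, ← Matrix.toLin'_apply', Matrix.toLin'_toMatrix']
  set φ := e.toLinearMap ∘ₗ qPolyMap F (c i - c j) ∘ₗ g
  have hφ : Module.finrank F (LinearMap.ker φ)
      ≤ Module.finrank F (LinearMap.ker (qPolyMap F (c i - c j))) := by
    rw [← finrank_map_of_injective hg (LinearMap.ker φ)]
    refine Submodule.finrank_mono ?_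
    rintro _ ⟨x, hx, rfl⟩
    simpa [φ] using hx
  have hrn := LinearMap.finrank_range_add_finrank_ker φ
  rw [Module.finrank_fin_fun] at hrn
  omega

theorem exists_rankCode (F : Type*) [Field F] [Finite F] {k n δ : ℕ} (hδ : 0 < δ)
    (hk : δ ≤ k) (hn : δ ≤ n) :
    ∃ f : Fin (Nat.card F ^ (max k n * (min k n - δ + 1))) → Matrix (Fin n) (Fin k) F,
      ∀ i j, i ≠ j → δ ≤ (f i - f j).rank := by
  rcases le_total k n with h | h
  · rw [max_eq_right h, min_eq_left h]
    exact exists_rankCode_of_le F hδ hk h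
  · rw [max_eq_left h, min_eq_right h]
    obtain ⟨f, hf⟩ := exists_rankCode_of_le F hδ hn h
    refine ⟨fun i => (f i).transpose, fun i j hij => ?_⟩
    rw [← Matrix.transpose_sub, Matrix.rank_transpose]
    exact hf i j hij

/-! ### Constant dimension codes in terms of intersections -/

theorem two_mul_le_subspaceDist_iff {F V : Type*} [Field F] [AddCommGroup V] [Module F V]
    [FiniteDimensional F V] {U W : Submodule F V} {k δ : ℕ} (hU : Module.finrank F U = k)
    (hW : Module.finrank F W = k) :
    2 * δ ≤ subspaceDist U W ↔ Module.finrank F ↥(U ⊓ W) + δ ≤ k := by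
  have h := Submodule.finrank_sup_add_finrank_inf_eq U W
  have h' : Module.finrank F ↥(U ⊓ W) ≤ Module.finrank F U := Submodule.finrank_mono inf_le_left
  unfold subspaceDist
  omega

/-- An optimal code in `F^v`, with the distance condition phrased through intersections. -/
theorem exists_card_eq_maxCodeSize (F : Type*) [Field F] [Finite F] (v δ k : ℕ) :
    ∃ C : Finset (Submodule F (Fin v → F)), C.card = maxCodeSize F v (2 * δ) k ∧
      (∀ U ∈ C, Module.finrank F U = k) ∧
      ∀ U ∈ C, ∀ W ∈ C, U ≠ W → Module.finrank F ↥(U ⊓ W) + δ ≤ k := by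
  obtain ⟨C, ⟨hk, hd⟩, hC⟩ := (isGreatest_maxCodeSize F v (2 * δ) k).1
  exact ⟨C, hC, hk, fun U hU W hW hne =>
    (two_mul_le_subspaceDist_iff (hk U hU) (hk W hW)).mp (hd U hU W hW hne)⟩

/-- A family of `k`-dimensional subspaces of any `v`-dimensional space whose members meet pairwise
in dimension at most `k - δ` bounds the maximum code size from below. As `δ` is positive, the members
are automatically distinct. -/
theorem card_le_maxCodeSize {F V ι : Type*} [Field F] [Finite F] [AddCommGroup V] [Module F V]
    [FiniteDimensional F V] [Fintype ι] {v δ k : ℕ} (hV : Module.finrank F V = v) (hδ : 0 < δ)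
    (f : ι → Submodule F V) (hf : ∀ i, Module.finrank F (f i) = k)
    (hdist : ∀ i j, i ≠ j → Module.finrank F ↥(f i ⊓ f j) + δ ≤ k) :
    Fintype.card ι ≤ maxCodeSize F v (2 * δ) k := by
  classical
  let e : V ≃ₗ[F] (Fin v → F) := LinearEquiv.ofFinrankEq _ _ (by simp [hV])
  have hinj : Function.Injective f := by
    intro i j hij
    by_contra hne
    have := hdist i j hne
    rw [hij, inf_idem, hf] at this
    omega
  let g : ι → Submodule F (Fin v → F) := fun i => Submodule.orderIsoMapComap e (f i)
  have hg : Function.Injective g := (Submodule.orderIsoMapComap e).injective.comp hinj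
  have hrank : ∀ W : Submodule F V,
      Module.finrank F (Submodule.orderIsoMapComap e W) = Module.finrank F W :=
    fun W => LinearEquiv.finrank_map_eq e W
  refine (isGreatest_maxCodeSize F v (2 * δ) k).2 ⟨Finset.univ.image g, ⟨?_, ?_⟩, ?_⟩
  · simp only [Finset.mem_image, Finset.mem_univ, true_and, forall_exists_index,
      forall_apply_eq_imp_iff]
    exact fun i => (hrank _).trans (hf i)
  · simp only [Finset.mem_image, Finset.mem_univ, true_and, forall_exists_index,
      forall_apply_eq_imp_iff]
    intro i j hij
    rw [two_mul_le_subspaceDist_iff ((hrank _).trans (hf i)) ((hrank _).trans (hf j)),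
      ← OrderIso.map_inf, hrank]
    exact hdist i j fun h => hij (h ▸ rfl)
  · rw [Finset.card_image_of_injective _ hg, Finset.card_univ]

/-! ### Lifted subspaces -/

section Lifting

variable {F E V₁ V₂ : Type*} [Field F] [AddCommGroup E] [Module F E] [AddCommGroup V₁]
  [Module F V₁] [AddCommGroup V₂] [Module F V₂]

theorem finrank_range_prod_of_injective {A : E →ₗ[F] V₁} (hA : Function.Injective A)
    (B : E →ₗ[F] V₂) :
    Module.finrank F (LinearMap.range (A.prod B)) = Module.finrank F E :=
  LinearMap.finrank_range_of_inj fun _ _ h => hA (congrArg Prod.fst h)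

/-- The projection to `V₁` is injective on the lifted subspace, so it preserves the dimension of
the intersection. -/
theorem finrank_range_prod_inf_le [FiniteDimensional F V₁] {A : E →ₗ[F] V₁} (hA : Function.Injective A) (B : E →ₗ[F] V₂)
    {W : Submodule F (V₁ × V₂)} {S : Submodule F V₁} (hW : ∀ w ∈ W, w.1 ∈ S) :
    Module.finrank F ↥(LinearMap.range (A.prod B) ⊓ W)
      ≤ Module.finrank F ↥(LinearMap.range A ⊓ S) := by
  have hmem : ∀ x ∈ LinearMap.range (A.prod B) ⊓ W,
      LinearMap.fst F V₁ V₂ x ∈ LinearMap.range A ⊓ S := by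
    rintro _ ⟨⟨y, rfl⟩, hy⟩
    exact ⟨⟨y, rfl⟩, hW _ hy⟩
  refine LinearMap.finrank_le_finrank_of_injective
    (f := (LinearMap.fst F V₁ V₂).restrict hmem) ?_
  rintro ⟨_, ⟨y, rfl⟩, _⟩ ⟨_, ⟨z, rfl⟩, _⟩ h
  have h' : A y = A z := congrArg Subtype.val h
  simp [hA h']

/-- Two lifts of the same subspace meet in the image of the kernel of `B - B'`. -/
theorem finrank_range_prod_inf_range_prod_le [FiniteDimensional F E] {A : E →ₗ[F] V₁}
    (hA : Function.Injective A) (B B' : E →ₗ[F] V₂) :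
    Module.finrank F ↥(LinearMap.range (A.prod B) ⊓ LinearMap.range (A.prod B'))
      + Module.finrank F (LinearMap.range (B - B')) ≤ Module.finrank F E := by
  have hle : LinearMap.range (A.prod B) ⊓ LinearMap.range (A.prod B')
      ≤ (LinearMap.ker (B - B')).map (A.prod B) := by
    rintro _ ⟨⟨y, rfl⟩, ⟨z, hz⟩⟩
    have hzy : z = y := hA (congrArg Prod.fst hz)
    subst hzy
    refine ⟨z, ?_, rfl⟩
    have h2 : B' z = B z := congrArg Prod.snd hz
    simp [h2]
  have h1 := (Submodule.finrank_mono hle).trans (Submodule.finrank_map_le _ _)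
  have h2 := LinearMap.finrank_range_add_finrank_ker (B - B')
  omega

end Lifting

/-! ### The combined code -/

theorem mainTheorem2 {F : Type*} [Field F] [Finite F] (v d k m : ℕ)
    (hk : 0 < k) (hkm : k ≤ m) (hmv : m + d / 2 ≤ v)
    (hd : Even d) (hd0 : 0 < d) (hdk : d ≤ 2 * k) :
    maxCodeSize F m d k * lmrdSize (Nat.card F) k (v - m + k) d
        + maxCodeSize F (v - m + k - d / 2) d k
      ≤ maxCodeSize F v d k := by
  obtain ⟨δ, rfl⟩ := hd.two_dvd
  obtain ⟨n, rfl⟩ : ∃ n, v = m + n := ⟨v - m, by omega⟩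
  have hdiv : 2 * δ / 2 = δ := by omega
  rw [hdiv] at hmv ⊢
  have hn : m + n - m = n := by omega
  have hδ : 0 < δ := by omega
  have hδk : δ ≤ k := by omega
  have hδn : δ ≤ n := by omega
  have hM : lmrdSize (Nat.card F) k (n + k) (2 * δ)
      = Nat.card F ^ (max k n * (min k n - δ + 1)) := by
    have : 2 * δ ≤ 2 * min k n := by omega
    simp [lmrdSize, hdiv, this]
  rw [hn, hM]
  obtain ⟨C₁, hC₁card, hC₁k, hC₁⟩ := exists_card_eq_maxCodeSize F m δ k
  obtain ⟨C₂, hC₂card, hC₂k, hC₂⟩ := exists_card_eq_maxCodeSize F (n + k - δ) δ k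
  obtain ⟨M, hMrank⟩ := exists_rankCode F hδ hδk hδn
  have hparam : ∀ U : C₁, ∃ A : (Fin k → F) →ₗ[F] (Fin m → F),
      Function.Injective A ∧ LinearMap.range A = U := by
    intro U
    let e : (Fin k → F) ≃ₗ[F] (U : Submodule F (Fin m → F)) :=
      LinearEquiv.ofFinrankEq _ _ (by simp [hC₁k U U.2])
    refine ⟨(U : Submodule F (Fin m → F)).subtype ∘ₗ e.toLinearMap,
      Subtype.val_injective.comp e.injective, ?_⟩
    rw [LinearMap.range_comp, LinearEquiv.range, Submodule.map_top, Submodule.range_subtype]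
  choose A hA hAU using hparam
  -- The ambient space of the second code, embedded as `S × F^n` with `S = range s`.
  obtain ⟨s, hs⟩ := exists_injective_linearMap_of_le_finrank (F := F) (V := Fin m → F) (n := k - δ)
    (by rw [Module.finrank_fin_fun]; omega)
  let e : (Fin (n + k - δ) → F) ≃ₗ[F] (Fin (k - δ) → F) × (Fin n → F) :=
    LinearEquiv.ofFinrankEq _ _ (by simp; omega)
  let j : (Fin (n + k - δ) → F) →ₗ[F] (Fin m → F) × (Fin n → F) :=
    s.prodMap LinearMap.id ∘ₗ e.toLinearMap
  have hj : Function.Injective j :=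
    (Function.Injective.prodMap hs Function.injective_id).comp e.injective
  let lift : C₁ × Fin (Nat.card F ^ (max k n * (min k n - δ + 1)))
      → Submodule F ((Fin m → F) × (Fin n → F)) :=
    fun x => LinearMap.range ((A x.1).prod (M x.2).mulVecLin)
  have hcross : ∀ x (W : C₂),
      Module.finrank F ↥(lift x ⊓ (W : Submodule F (Fin (n + k - δ) → F)).map j) + δ ≤ k := by
    intro x W
    have h1 : Module.finrank F ↥(lift x ⊓ (W : Submodule F (Fin (n + k - δ) → F)).map j)
        ≤ Module.finrank F ↥(LinearMap.range (A x.1) ⊓ LinearMap.range s) := by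
      refine finrank_range_prod_inf_le (hA x.1) _ ?_
      rintro _ ⟨w, -, rfl⟩
      exact ⟨(e w).1, rfl⟩
    have h2 : Module.finrank F ↥(LinearMap.range (A x.1) ⊓ LinearMap.range s)
        ≤ Module.finrank F (LinearMap.range s) := Submodule.finrank_mono inf_le_right
    rw [LinearMap.finrank_range_of_inj hs, Module.finrank_fin_fun] at h2
    omega
  have hmain := card_le_maxCodeSize (F := F) (V := (Fin m → F) × (Fin n → F)) (v := m + n) (k := k)
    (by simp) hδ
    (Sum.elim lift fun W : C₂ => (W : Submodule F (Fin (n + k - δ) → F)).map j) ?_ ?_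
  · simpa [Fintype.card_sum, Fintype.card_prod, hC₁card, hC₂card] using hmain
  · rintro (x | W)
    · exact (finrank_range_prod_of_injective (hA x.1) _).trans (Module.finrank_fin_fun F)
    · exact (finrank_map_of_injective hj _).trans (hC₂k W W.2)
  · rintro (⟨U, a⟩ | W) (⟨U', b⟩ | W') hne
    · by_cases hU : U = U'
      · subst hU
        have hab : a ≠ b := fun h => hne (by rw [h])
        have h1 := finrank_range_prod_inf_range_prod_le (hA U) (M a).mulVecLin (M b).mulVecLin
        have h2 := hMrank a b hab
        rw [Matrix.rank, ← Matrix.toLin'_apply', map_sub] at h2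
        simp only [Matrix.toLin'_apply'] at h2
        rw [Module.finrank_fin_fun] at h1
        exact (Nat.add_le_add_left h2 _).trans h1
      · have h1 : Module.finrank F ↥(lift (U, a) ⊓ lift (U', b))
            ≤ Module.finrank F ↥(LinearMap.range (A U) ⊓ LinearMap.range (A U')) := by
          refine finrank_range_prod_inf_le (hA U) _ ?_
          rintro _ ⟨y, rfl⟩
          exact ⟨y, rfl⟩
        rw [hAU, hAU] at h1
        exact (Nat.add_le_add_right h1 _).trans
          (hC₁ U U.2 U' U'.2 fun h => hU (Subtype.ext h))
    · exact hcross _ _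
    · rw [inf_comm]
      exact hcross _ _
    · have h := hC₂ W W.2 W' W'.2 fun h => hne (by rw [Subtype.ext h])
      rw [← finrank_map_of_injective hj, Submodule.map_inf _ hj] at h
      exact h
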